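/- Let $(\Omega,\mathcal F,(\mathcal F_t)_{t\ge 0},\mathbb P)$ be a probability space with a right-continuous complete filtration, and let $T,\mu_0,\kappa,\alpha,\beta>0$. Let $0<\tau_1<\tau_2<\cdots$ be stopping times (arrival times). Each arrival $\tau_i$ carries a type in $\{+,-\}$ and a jump size $J_i>0$, both $\mathcal F_{\tau_i}$-measurable. The $J_i$ are i.i.d. with the law of a random variable $J$ with $\mathbb E(J^2)<\infty$, and $\alpha\,\mathbb E(J)<\beta$. Let $N^{\pm}_t$ be the number of arrivals of type $\pm$ in $[0,t]$, let $f^\pm_t=\int_0^tJ_s\,dN^\pm_s$ be the sum of their jump sizes, and let $$\lambda^+_t=\mu_0e^{\kappa t/T}+\int_0^t\alpha e^{-\beta(t-s)}J_s\,dN^-_s,\qquad \lambda^-_t=\mu_0e^{\kappa t/T}+\int_0^t\alpha e^{-\beta(t-s)}J_s\,dN^+_s .$$ Assume that this is a marked Hawkes process on $[0,T]$ with intensities $\lambda^\pm$: for each sign, the random measure $\sum_{i:\,\tau_i\text{ of type }\pm}\delta_{(\tau_i,J_i)}$ has compensator $\lambda^\pm_t\,dt\otimes\mathrm{Law}(J)(dx)$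 on $[0,T]\times(0,\infty)$, i.e. for every Borel set $B\subseteq\mathbb R$ and every $n\ge1$ the process $$t\mapsto \#\{i:\ \tau_i\le t\wedge T\wedge\tau_n,\ \tau_i\text{ of type }\pm,\ J_i\in B\}-\mathbb P(J\in B)\int_0^{t\wedge T\wedge\tau_n}\lambda^\pm_s\,ds$$ is a martingale. Then for every $t\in[0,T]$ the variables $f^\pm_t$ and $\lambda^\pm_t$ are integrable, with $$\mathbb E(f^+_t)=\mathbb E(f^-_t)=\mu_0\mathbb E(J)\left(\frac{\beta+\frac\kappa T}{\frac\kappa T\left(\beta-\alpha\mathbb E(J)+\frac\kappa T\right)}e^{\kappa\frac tT}+\frac{\alpha\mathbb E(J)}{(\beta-\alpha\mathbb E(J))\left(\beta-\alpha\mathbb E(J)+\frac\kappa T\right)}e^{-(\beta-\alpha\mathbb E(J))t}-\frac{\beta}{\frac\kappa T(\beta-\alpha\mathbb E(J))}\right)$$ and $$\mathbb E(\lambda^+_t)=\mathbb E(\lambda^-_t)=\mu_0\left(\frac{\beta+\frac\kappa T}{\beta-\alpha\mathbb E(J)+\frac\kappa T}e^{\kappa\frac tT}-\frac{\alpha\mathbb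 E(J)}{\beta-\alpha\mathbb E(J)+\frac\kappa T}e^{-(\beta-\alpha\mathbb E(J))t}\right).$$ In particular the expected market activity $\mathbb E(\lambda^+_t+\lambda^-_t)$ increases exponentially at rate $\kappa/T$: it is strictly increasing in $t\in[0,T]$, and for all $t\in[0,T]$ $$2\mu_0e^{\kappa\frac tT}\le\mathbb E(\lambda^+_t+\lambda^-_t)\le 2\mu_0\,\frac{\beta+\frac\kappa T}{\beta-\alpha\mathbb E(J)+\frac\kappa T}\,e^{\kappa\frac tT}.$$ -/

import Mathlib

open MeasureTheory ProbabilityTheory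
open scoped NNReal

namespace MarkedHawkes

variable {Ω : Type*}

/-- Integral against a component of the marked bivariate point process: the `i`-th event (`i : ℕ`)
arrives at time `τ i`, has type `ε i` (`0` for "+", `1` for "-") and mark `J i`, and
`markedIntegral τ ε J a h t` is the sum of `h (τ i) (J i)` over the events of type `a` that arrive
in `[0, t]`, that is `∫_{[0,t]} ∫ h(s, x) N^a(ds, dx)`. -/
noncomputable def markedIntegral (τ : ℕ → Ω → ℝ≥0) (ε : ℕ → Ω → Fin 2) (J : ℕ → Ω → ℝ)
    (a : Fin 2) (h : ℝ → ℝ → ℝ) (t : ℝ) (ω : Ω) : ℝ :=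
  ∑' i, if (τ i ω : ℝ) ≤ t ∧ ε i ω = a then h (τ i ω) (J i ω) else 0

/-- `N^a_t(B)`: the number of events of type `a` in `[0, t]` whose mark lies in `B`. -/
noncomputable def markedCount (τ : ℕ → Ω → ℝ≥0) (ε : ℕ → Ω → Fin 2) (J : ℕ → Ω → ℝ)
    (a : Fin 2) (B : Set ℝ) (t : ℝ) (ω : Ω) : ℝ :=
  markedIntegral τ ε J a (fun _ x => B.indicator (fun _ => (1 : ℝ)) x) t ω

/-- `f^a_t = ∫_0^t J_s dN^a_s`: the sum of the jump sizes of type `a` up to time `t`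
(`a = 0`: upward jumps `f^+`, `a = 1`: downward jumps `f^-`). -/
noncomputable def jumpSum (τ : ℕ → Ω → ℝ≥0) (ε : ℕ → Ω → Fin 2) (J : ℕ → Ω → ℝ)
    (a : Fin 2) (t : ℝ) (ω : Ω) : ℝ :=
  markedIntegral τ ε J a (fun _ x => x) t ω

/-- The Hawkes intensity
`λ^a_t = μ(t/T) + ∑_b ∫_0^t φ_{ab}(t - s) J_s dN^b_s`
(`a = 0`: `λ^+`, `a = 1`: `λ^-`). -/
noncomputable def intensity (T : ℝ≥0) (μ : ℝ → ℝ) (φ : ℝ → Matrix (Fin 2) (Fin 2) ℝ)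
    (τ : ℕ → Ω → ℝ≥0) (ε : ℕ → Ω → Fin 2) (J : ℕ → Ω → ℝ)
    (a : Fin 2) (t : ℝ) (ω : Ω) : ℝ :=
  μ (t / T) + ∑ b, markedIntegral τ ε J b (fun s x => φ (t - s) a b * x) t ω

/-- `N^a_t(B) - ∫_0^t λ^a_s ds · P(J₀ ∈ B)`: the count of the events of type `a` with mark in `B`,
compensated by `λ^a_s ds ⊗ Law(J₀)(dx)`. -/
noncomputable def compensatedCount [MeasurableSpace Ω] (P : Measure Ω) (J₀ : Ω → ℝ)
    (T : ℝ≥0) (μ : ℝ → ℝ) (φ : ℝ → Matrix (Fin 2) (Fin 2) ℝ)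
    (τ : ℕ → Ω → ℝ≥0) (ε : ℕ → Ω → Fin 2) (J : ℕ → Ω → ℝ)
    (a : Fin 2) (B : Set ℝ) (t : ℝ) (ω : Ω) : ℝ :=
  markedCount τ ε J a B t ω -
    (∫ s in (0 : ℝ)..t, intensity T μ φ τ ε J a s ω) * (P.map J₀).real B

/-- The bivariate marked Hawkes process on `[0, T]` with baseline `μ`, excitation matrix `φ` and
i.i.d. positive marks distributed as `J₀`, on a filtered probability space. -/
structure IsMarkedHawkes {mΩ : MeasurableSpace Ω} (P : Measure Ω) (ℱ : Filtration ℝ≥0 mΩ)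
    (J₀ : Ω → ℝ) (T : ℝ≥0) (μ : ℝ → ℝ) (φ : ℝ → Matrix (Fin 2) (Fin 2) ℝ)
    (τ : ℕ → Ω → ℝ≥0) (ε : ℕ → Ω → Fin 2) (J : ℕ → Ω → ℝ) : Prop where
  /-- the filtration is right continuous and complete -/
  rightContinuous : ℱ.IsRightContinuous
  complete : ∀ A : Set Ω, P A = 0 → MeasurableSet[ℱ 0] A
  /-- the arrival times are stopping times with `0 < τ_1 < τ_2 < ⋯` -/
  isStoppingTime : ∀ i, IsStoppingTime ℱ (fun ω => (τ i ω : WithTop ℝ≥0))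
  arrival_pos : ∀ ω, 0 < τ 0 ω
  arrival_strictMono : ∀ ω, StrictMono (fun i => τ i ω)
  /-- the type and the mark of an event are known at its arrival -/
  type_measurable : ∀ i, Measurable[(isStoppingTime i).measurableSpace] (ε i)
  mark_measurable : ∀ i, Measurable[(isStoppingTime i).measurableSpace] (J i)
  /-- the marks are positive, independent and distributed as `J₀` -/
  mark_pos : ∀ i ω, 0 < J i ω
  mark_indep : iIndepFun J P
  mark_identDistrib : ∀ i, IdentDistrib (J i) J₀ P P
  /-- `N^a(ds, dx)` has compensator `λ^a_s ds ⊗ Law(J₀)(dx)` on `[0, T]`: for all Borel sets `B` of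
  marks, the compensated count of marks in `B` is a local martingale on `[0, T]`, localized by the
  arrival times. -/
  compensator : ∀ (a : Fin 2) (B : Set ℝ), MeasurableSet B → ∀ n : ℕ,
    Martingale (fun (t : ℝ≥0) ω =>
      compensatedCount P J₀ T μ φ τ ε J a B ((min t (min T (τ n ω)) : ℝ≥0) : ℝ) ω) ℱ P

/-- The exponential baseline `μ(u) = μ₀ e^{κ u}`. -/
noncomputable def expBaseline (μ₀ κ : ℝ) (u : ℝ) : ℝ := μ₀ * Real.exp (κ * u)

/-- The purely mutual exponential excitation: zero diagonal, off-diagonal `α e^{-β u}`. -/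
noncomputable def expExcitation (α β : ℝ) (u : ℝ) : Matrix (Fin 2) (Fin 2) ℝ :=
  !![0, α * Real.exp (-β * u); α * Real.exp (-β * u), 0]

end MarkedHawkes

/-! Write m = E(J), c = κ/T, and let D^b be the discounted sum of the jumps of type b, so that λ^a =
μ₀ e^{ct} + α D^b with b the opposite type. The compensator applied to the mark size should give E
f^a_t = m E ∫_0^t λ^a. Each jump x at time u contributes x(1 - e^{-β(t-u)})/β to ∫_0^t D, so f = D +
β ∫ D. Taking expectations, the functions G_a = E D^a solve a closed linear Volterra system;
subtracting its two equations gives G_0 = G_1, and the remaining scalar equation has an explicit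
solution.

The work lies in justifying the expectations, since the martingale property holds only up to τ_n and
for indicators of mark sets. Read as an identity in B it is an equality of finite measures, which
can be integrated against x (`sum_integral_jumpTerm`). Bounding the stopped compensators by one
another, with factor αm/β < 1, gives a bound uniform in n (`integral_compensator_le`), hence
finitely many arrivals on [0, T] almost surely. Then n → ∞ is allowed
(`integral_jumpSum_eq_compensator`), Fubini closes the system
(`intervalIntegrable_and_integral_discountedSum`), and `eq_explicit_of_integral_system` solves it.
-/

namespace MarkedHawkes

variable {Ω : Type*}

/-- The contribution of the `i`-th event to `markedIntegral τ ε J b h t`. -/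
noncomputable def eventTerm (τ : ℕ → Ω → ℝ≥0) (ε : ℕ → Ω → Fin 2) (J : ℕ → Ω → ℝ)
    (b : Fin 2) (h : ℝ → ℝ → ℝ) (t : ℝ) (i : ℕ) (ω : Ω) : ℝ :=
  if (τ i ω : ℝ) ≤ t ∧ ε i ω = b then h (τ i ω) (J i ω) else 0

/-- The sum of the exponentially discounted jump sizes of type `b` up to time `t`. -/
noncomputable def discountedSum (β : ℝ) (τ : ℕ → Ω → ℝ≥0) (ε : ℕ → Ω → Fin 2) (J : ℕ → Ω → ℝ)
    (b : Fin 2) (t : ℝ) (ω : Ω) : ℝ :=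
  markedIntegral τ ε J b (fun s x => x * Real.exp (-β * (t - s))) t ω

/-! ### Pathwise formulas before a given arrival time -/

section Deterministic

variable {τ : ℕ → Ω → ℝ≥0} {ε : ℕ → Ω → Fin 2} {J : ℕ → Ω → ℝ} {ω : Ω}

/-- Later events arrive strictly after τ_n. Event n itself must be kept, because s may equal τ_n. -/
theorem markedIntegral_eq_sum (hτ : StrictMono fun i => τ i ω) (b : Fin 2) (h : ℝ → ℝ → ℝ)
    {n : ℕ} {s : ℝ} (hs : s ≤ τ n ω) :
    markedIntegral τ ε J b h s ω = ∑ i ∈ Finset.range (n + 1), eventTerm τ ε J b h s i ω := by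
  refine tsum_eq_sum fun i hi => if_neg fun hh => ?_
  have : n < i := by
    rw [Finset.mem_range] at hi
    omega
  have h1 : τ n ω < τ i ω := hτ this
  have h2 : (τ n ω : ℝ) < τ i ω := by exact_mod_cast h1
  linarith [hh.1]

/-- In `Fin 2`, `a + 1` is the opposite type, the only one that excites type `a`. No summability is
needed: constants always factor out of a real `tsum`. -/
theorem intensity_eq (T : ℝ≥0) (μ₀ κ α β : ℝ) (a : Fin 2) (t : ℝ) (ω : Ω) :
    intensity T (expBaseline μ₀ κ) (expExcitation α β) τ ε J a t ω =
      μ₀ * Real.exp (κ / T * t) + α * discountedSum β τ ε J (a + 1) t ω := by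
  have h0 : ∀ b, markedIntegral τ ε J b (fun _ _ => 0) t ω = 0 := fun b => by
    simp [markedIntegral]
  have h1 : ∀ b, markedIntegral τ ε J b
      (fun s x => α * Real.exp (-β * (t - s)) * x) t ω = α * discountedSum β τ ε J b t ω := by
    intro b
    rw [discountedSum, markedIntegral, markedIntegral, ← tsum_mul_left]
    congr 1; ext i
    split_ifs <;> ring
  have h2 : κ * (t / T) = κ / T * t := by ring
  fin_cases a <;> simp [intensity, expBaseline, expExcitation, Fin.sum_univ_two, h0, ← h1, h2]

theorem integral_exp_linear {c : ℝ} (hc : c ≠ 0) (a b d : ℝ) :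
    ∫ s in a..b, Real.exp (c * (s - d)) =
      (Real.exp (c * (b - d)) - Real.exp (c * (a - d))) / c := by
  have h : ∀ x, HasDerivAt (fun s => Real.exp (c * (s - d)) / c) (Real.exp (c * (x - d))) x := by
    intro x
    have := ((((hasDerivAt_id x).sub_const d).const_mul c).exp).div_const c
    refine this.congr_deriv ?_
    simp only [id_eq]
    field_simp
  rw [intervalIntegral.integral_eq_sub_of_hasDerivAt (fun x _ => h x)
    (by apply Continuous.intervalIntegrable; fun_prop)]
  ring

theorem discount_eq_indicator (β x u : ℝ) :
    (fun s : ℝ => if u ≤ s then x * Real.exp (-β * (s - u)) else 0) =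
      (Set.Ici u).indicator fun s => x * Real.exp (-β * (s - u)) := by
  ext s; simp [Set.indicator]

theorem intervalIntegrable_discount (β x u a b : ℝ) :
    IntervalIntegrable (fun s : ℝ => if u ≤ s then x * Real.exp (-β * (s - u)) else 0)
      volume a b := by
  have h : IntervalIntegrable (fun s : ℝ => x * Real.exp (-β * (s - u))) volume a b := by
    apply Continuous.intervalIntegrable; fun_prop
  rw [discount_eq_indicator]
  exact ⟨h.1.indicator measurableSet_Ici, h.2.indicator measurableSet_Ici⟩

theorem integral_discount {β : ℝ} (hβ : β ≠ 0) (x : ℝ) {u t : ℝ} (hu : 0 ≤ u) (ht : 0 ≤ t) :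
    ∫ s in (0 : ℝ)..t, (if u ≤ s then x * Real.exp (-β * (s - u)) else 0) =
      if u ≤ t then x * (1 - Real.exp (-β * (t - u))) / β else 0 := by
  have hzero : ∀ r ≤ u, 0 ≤ r →
      ∫ s in (0 : ℝ)..r, (if u ≤ s then x * Real.exp (-β * (s - u)) else 0) = 0 := by
    -- Passing to the open interval removes the endpoint s = u, where the integrand already equals
    -- x.
    intro r hr hr0
    rw [intervalIntegral.integral_of_le hr0, integral_Ioc_eq_integral_Ioo]
    refine setIntegral_eq_zero_of_forall_eq_zero fun s hs => if_neg ?_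
    have := hs.2
    linarith
  split_ifs with h
  · rw [← intervalIntegral.integral_add_adjacent_intervals
      (intervalIntegrable_discount β x u 0 u) (intervalIntegrable_discount β x u u t),
      hzero u le_rfl hu, zero_add]
    rw [intervalIntegral.integral_congr (g := fun s => x * Real.exp (-β * (s - u)))]
    · rw [intervalIntegral.integral_const_mul, integral_exp_linear (neg_ne_zero.2 hβ)]
      simp
      field_simp
      ring
    · intro s hs
      rw [Set.uIcc_of_le h] at hs
      exact if_pos hs.1
  · exact hzero t (le_of_not_ge h) ht

theorem eventTerm_discount (β : ℝ) (b : Fin 2) (s : ℝ) (i : ℕ) (ω : Ω) :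
    eventTerm τ ε J b (fun u x => x * Real.exp (-β * (s - u))) s i ω =
      if (τ i ω : ℝ) ≤ s then
        (if ε i ω = b then J i ω else 0) * Real.exp (-β * (s - τ i ω)) else 0 := by
  unfold eventTerm
  split_ifs with h1 h2 h3 h4 <;> simp_all

theorem intervalIntegrable_eventTerm (β : ℝ) (b : Fin 2) (i : ℕ) (ω : Ω) (r t : ℝ) :
    IntervalIntegrable (fun s => eventTerm τ ε J b (fun u x => x * Real.exp (-β * (s - u))) s i ω)
      volume r t := by
  simp only [eventTerm_discount]
  exact intervalIntegrable_discount _ _ _ _ _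

theorem integral_eventTerm {β : ℝ} (hβ : β ≠ 0) (b : Fin 2) (i : ℕ) (ω : Ω) {t : ℝ} (ht : 0 ≤ t) :
    ∫ s in (0 : ℝ)..t, eventTerm τ ε J b (fun u x => x * Real.exp (-β * (s - u))) s i ω =
      eventTerm τ ε J b (fun u x => x * (1 - Real.exp (-β * (t - u)))) t i ω / β := by
  simp only [eventTerm_discount]
  rw [integral_discount hβ _ (NNReal.coe_nonneg _) ht]
  unfold eventTerm
  split_ifs with h1 h2 h3 h4 <;> simp_all

/-- Up to τ_n only finitely many events matter, so sum and time integral commute without any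
convergence question. -/
theorem integral_intensity (hτ : StrictMono fun i => τ i ω) (T : ℝ≥0) (μ₀ κ α : ℝ) {β : ℝ}
    (hκ : κ / T ≠ 0) (hβ : β ≠ 0) (a : Fin 2) {n : ℕ} {t : ℝ} (ht0 : 0 ≤ t) (ht : t ≤ τ n ω) :
    ∫ s in (0 : ℝ)..t, intensity T (expBaseline μ₀ κ) (expExcitation α β) τ ε J a s ω =
      μ₀ * ((Real.exp (κ / T * t) - 1) / (κ / T)) + α / β * ∑ i ∈ Finset.range (n + 1),
        eventTerm τ ε J (a + 1) (fun u x => x * (1 - Real.exp (-β * (t - u)))) t i ω := by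
  rw [intervalIntegral.integral_congr (g := fun s => μ₀ * Real.exp (κ / T * (s - 0)) +
    α * ∑ i ∈ Finset.range (n + 1),
      eventTerm τ ε J (a + 1) (fun u x => x * Real.exp (-β * (s - u))) s i ω)]
  · rw [intervalIntegral.integral_add, intervalIntegral.integral_const_mul,
      intervalIntegral.integral_const_mul, intervalIntegral.integral_finsetSum,
      integral_exp_linear hκ]
    · simp_rw [integral_eventTerm hβ _ _ _ ht0, ← Finset.sum_div]
      simp
      ring
    · exact fun i _ => intervalIntegrable_eventTerm _ _ _ _ _ _
    · apply Continuous.intervalIntegrable; fun_prop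
    · refine IntervalIntegrable.const_mul ?_ _
      simpa only [Finset.sum_fn] using IntervalIntegrable.sum (Finset.range (n + 1)) fun i _ =>
        intervalIntegrable_eventTerm (τ := τ) (ε := ε) (J := J) β (a + 1) i ω 0 t
  · intro s hs
    rw [Set.uIcc_of_le ht0] at hs
    simp only
    rw [intensity_eq, discountedSum, markedIntegral_eq_sum hτ _ _ (hs.2.trans ht), sub_zero]

/-- Stopping at τ_n loses none of the events with index at most n. -/
theorem eventTerm_min (hτ : StrictMono fun i => τ i ω) (b : Fin 2) (h : ℝ → ℝ → ℝ) (t : ℝ)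
    {i n : ℕ} (hi : i ∈ Finset.range (n + 1)) :
    eventTerm τ ε J b h (min t (τ n ω)) i ω = eventTerm τ ε J b h t i ω := by
  have h1 : τ i ω ≤ τ n ω := hτ.monotone (Nat.lt_succ_iff.1 (Finset.mem_range.1 hi))
  have h2 : (τ i ω : ℝ) ≤ τ n ω := by exact_mod_cast h1
  simp [eventTerm, h2]

theorem eventTerm_nonneg {b : Fin 2} {h : ℝ → ℝ → ℝ} {t : ℝ} {i : ℕ}
    (hh : (τ i ω : ℝ) ≤ t → 0 ≤ h (τ i ω) (J i ω)) : 0 ≤ eventTerm τ ε J b h t i ω := by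
  unfold eventTerm
  split_ifs with h1
  exacts [hh h1.1, le_rfl]

theorem eventTerm_le_eventTerm {b : Fin 2} {h k : ℝ → ℝ → ℝ} {t : ℝ} {i : ℕ}
    (hh : (τ i ω : ℝ) ≤ t → h (τ i ω) (J i ω) ≤ k (τ i ω) (J i ω)) :
    eventTerm τ ε J b h t i ω ≤ eventTerm τ ε J b k t i ω := by
  unfold eventTerm
  split_ifs with h1
  exacts [hh h1.1, le_rfl]

end Deterministic

/-- A pointwise series of functions with summable `L¹` norms is integrable. -/
theorem integrable_tsum_of_summable_integral_norm {X : Type*} {mX : MeasurableSpace X}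
    {μ : Measure X} {F : ℕ → X → ℝ} (hF : ∀ i, Integrable (F i) μ)
    (hs : Summable fun i => ∫ x, ‖F i x‖ ∂μ) : Integrable (fun x => ∑' i, F i x) μ := by
  have hfin : ∑' i, ∫⁻ x, ‖F i x‖ₑ ∂μ ≠ ⊤ := by
    have : ∀ i, ∫⁻ x, ‖F i x‖ₑ ∂μ = ENNReal.ofReal (∫ x, ‖F i x‖ ∂μ) := fun i => by
      rw [ofReal_integral_norm_eq_lintegral_enorm (hF i)]
    simp_rw [this]
    exact hs.tsum_ofReal_ne_top
  have hlin : ∫⁻ x, ∑' i, ‖F i x‖ₑ ∂μ ≠ ⊤ := by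
    rwa [lintegral_tsum fun i => (hF i).1.enorm]
  have hae : ∀ᵐ x ∂μ, ∑' i, ‖F i x‖ₑ < ⊤ :=
    ae_lt_top' (AEMeasurable.tsum fun i => (hF i).1.enorm) hlin
  have hsum : ∀ᵐ x ∂μ, Summable fun i => ‖F i x‖ := by
    filter_upwards [hae] with x hx
    have := ENNReal.summable_toReal hx.ne
    simpa using this
  refine ⟨aestronglyMeasurable_of_tendsto_ae Filter.atTop
    (f := fun n x => ∑ i ∈ Finset.range n, F i x)
    (fun n => Finset.aestronglyMeasurable_fun_sum _ fun i _ => (hF i).1) ?_, ?_⟩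
  · filter_upwards [hsum] with x hx
    exact hx.of_norm.hasSum.tendsto_sum_nat
  · refine lt_of_le_of_lt (lintegral_mono_ae ?_) hlin.lt_top
    filter_upwards [hsum] with x hx
    exact enorm_tsum_le_tsum_enorm

/-! ### Measurability of single event terms -/

section Measurability

variable {mΩ : MeasurableSpace Ω} {τ : ℕ → Ω → ℝ≥0} {ε : ℕ → Ω → Fin 2} {J : ℕ → Ω → ℝ}

theorem measurable_uncurry_eventTerm {i : ℕ} (hτ : Measurable (τ i)) (hε : Measurable (ε i))
    (hJ : Measurable (J i)) (b : Fin 2) {h : ℝ → ℝ → ℝ → ℝ}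
    (hh : Measurable fun p : ℝ × ℝ × ℝ => h p.1 p.2.1 p.2.2) :
    Measurable fun p : ℝ × Ω => eventTerm τ ε J b (h p.1) p.1 i p.2 := by
  unfold eventTerm
  have hτ' : Measurable fun p : ℝ × Ω => (τ i p.2 : ℝ) :=
    measurable_coe_nnreal_real.comp (hτ.comp measurable_snd)
  refine Measurable.ite ?_ ?_ measurable_const
  · exact (measurableSet_le hτ' measurable_fst).inter
      ((hε.comp measurable_snd) (measurableSet_singleton b))
  · exact hh.comp (measurable_fst.prodMk (hτ'.prodMk (hJ.comp measurable_snd)))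

theorem measurable_eventTerm {i : ℕ} (hτ : Measurable (τ i)) (hε : Measurable (ε i))
    (hJ : Measurable (J i)) (b : Fin 2) {h : ℝ → ℝ → ℝ}
    (hh : Measurable fun p : ℝ × ℝ => h p.1 p.2) (t : ℝ) :
    Measurable (eventTerm τ ε J b h t i) :=
  (measurable_uncurry_eventTerm hτ hε hJ b (h := fun _ => h) (hh.comp measurable_snd)).comp
    (measurable_const.prodMk measurable_id : Measurable fun ω : Ω => (t, ω))

end Measurability

namespace IsMarkedHawkes

variable {mΩ : MeasurableSpace Ω} {P : Measure Ω}
  {ℱ : Filtration ℝ≥0 mΩ} {J₀ : Ω → ℝ} {T : ℝ≥0} {τ : ℕ → Ω → ℝ≥0} {ε : ℕ → Ω → Fin 2}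
  {J : ℕ → Ω → ℝ}

/-! ### Consequences of the compensator stopped at arrival times -/

section General

variable {μ : ℝ → ℝ} {φ : ℝ → Matrix (Fin 2) (Fin 2) ℝ}

theorem measurable_arrival (hN : IsMarkedHawkes P ℱ J₀ T μ φ τ ε J) (i : ℕ) :
    Measurable (τ i) := by
  refine measurable_of_Iic fun x => ?_
  have := ℱ.le x _ ((hN.isStoppingTime i).measurableSet_le x)
  simp only [WithTop.coe_le_coe] at this
  exact this

theorem measurable_type (hN : IsMarkedHawkes P ℱ J₀ T μ φ τ ε J) (i : ℕ) :
    Measurable (ε i) :=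
  (hN.type_measurable i).mono (hN.isStoppingTime i).measurableSpace_le le_rfl

theorem measurable_mark (hN : IsMarkedHawkes P ℱ J₀ T μ φ τ ε J) (i : ℕ) :
    Measurable (J i) :=
  (hN.mark_measurable i).mono (hN.isStoppingTime i).measurableSpace_le le_rfl

theorem integrable_mark (hN : IsMarkedHawkes P ℱ J₀ T μ φ τ ε J) (hJ₀ : Integrable J₀ P)
    (i : ℕ) : Integrable (J i) P :=
  (hN.mark_identDistrib i).integrable_iff.2 hJ₀

theorem integral_mark_nonneg (hN : IsMarkedHawkes P ℱ J₀ T μ φ τ ε J) :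
    0 ≤ ∫ ω, J₀ ω ∂P := by
  rw [← (hN.mark_identDistrib 0).integral_eq]
  exact integral_nonneg fun ω => (hN.mark_pos 0 ω).le

theorem integrable_eventTerm (hN : IsMarkedHawkes P ℱ J₀ T μ φ τ ε J) (hJ₀ : Integrable J₀ P)
    (b : Fin 2) {h : ℝ → ℝ → ℝ} (hh : Measurable fun p : ℝ × ℝ => h p.1 p.2) {t : ℝ}
    (hle : ∀ u ≤ t, ∀ x, 0 < x → |h u x| ≤ x) (i : ℕ) :
    Integrable (eventTerm τ ε J b h t i) P := by
  refine (hN.integrable_mark hJ₀ i).mono' (measurable_eventTerm (hN.measurable_arrival i)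
    (hN.measurable_type i) (hN.measurable_mark i) b hh t).aestronglyMeasurable
    (Filter.Eventually.of_forall fun ω => ?_)
  unfold eventTerm
  split_ifs with h1
  · exact hle _ h1.1 _ (hN.mark_pos i ω)
  · simpa using (hN.mark_pos i ω).le

theorem integrable_jumpTerm (hN : IsMarkedHawkes P ℱ J₀ T μ φ τ ε J) (hJ₀ : Integrable J₀ P)
    (b : Fin 2) (t : ℝ) (i : ℕ) :
    Integrable (eventTerm τ ε J b (fun _ x => x) t i) P :=
  hN.integrable_eventTerm hJ₀ b measurable_snd (fun _ _ _ hx => (abs_of_pos hx).le) i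

theorem jumpTerm_nonneg (hN : IsMarkedHawkes P ℱ J₀ T μ φ τ ε J) (b : Fin 2) (t : ℝ) (i : ℕ)
    (ω : Ω) : 0 ≤ eventTerm τ ε J b (fun _ x => x) t i ω :=
  eventTerm_nonneg fun _ => (hN.mark_pos i ω).le

theorem markedCount_min (hN : IsMarkedHawkes P ℱ J₀ T μ φ τ ε J) (a : Fin 2) (B : Set ℝ) (t : ℝ)
    (n : ℕ) (ω : Ω) : markedCount τ ε J a B (min t (τ n ω)) ω =
      ∑ i ∈ Finset.range (n + 1),
        ({ω | (τ i ω : ℝ) ≤ t ∧ ε i ω = a} ∩ J i ⁻¹' B).indicator (fun _ => (1 : ℝ)) ω := by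
  rw [markedCount, markedIntegral_eq_sum (hN.arrival_strictMono ω) _ _ (min_le_right _ _)]
  refine Finset.sum_congr rfl fun i hi => ?_
  rw [eventTerm_min (hN.arrival_strictMono ω) _ _ _ hi]
  unfold eventTerm
  simp only [Set.indicator, Set.mem_inter_iff, Set.mem_ofPred_eq, Set.mem_preimage]
  split_ifs <;> simp_all

theorem measurableSet_event (hN : IsMarkedHawkes P ℱ J₀ T μ φ τ ε J) (a : Fin 2) (t : ℝ) (i : ℕ) :
    MeasurableSet {ω | (τ i ω : ℝ) ≤ t ∧ ε i ω = a} :=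
  (measurableSet_le (measurable_coe_nnreal_real.comp (hN.measurable_arrival i))
    measurable_const).inter (hN.measurable_type i (measurableSet_singleton a))

theorem integrable_markedCount_min [IsFiniteMeasure P]
    (hN : IsMarkedHawkes P ℱ J₀ T μ φ τ ε J) (a : Fin 2)
    {B : Set ℝ} (hB : MeasurableSet B) (t : ℝ) (n : ℕ) :
    Integrable (fun ω => markedCount τ ε J a B (min t (τ n ω)) ω) P := by
  simp_rw [hN.markedCount_min]
  exact integrable_finsetSum _ fun i _ => (integrable_const _).indicator
    ((hN.measurableSet_event a t i).inter (hN.measurable_mark i hB))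

theorem integral_markedCount_min [IsFiniteMeasure P]
    (hN : IsMarkedHawkes P ℱ J₀ T μ φ τ ε J) (a : Fin 2)
    {B : Set ℝ} (hB : MeasurableSet B) (t : ℝ) (n : ℕ) :
    ∫ ω, markedCount τ ε J a B (min t (τ n ω)) ω ∂P = ∑ i ∈ Finset.range (n + 1),
      P.real ({ω | (τ i ω : ℝ) ≤ t ∧ ε i ω = a} ∩ J i ⁻¹' B) := by
  have hm : ∀ i, MeasurableSet ({ω | (τ i ω : ℝ) ≤ t ∧ ε i ω = a} ∩ J i ⁻¹' B) :=
    fun i => (hN.measurableSet_event a t i).inter (hN.measurable_mark i hB)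
  simp_rw [hN.markedCount_min]
  rw [integral_finsetSum _ fun i _ => (integrable_const _).indicator (hm i)]
  refine Finset.sum_congr rfl fun i _ => ?_
  rw [integral_indicator (hm i)]
  simp [measureReal_def]

theorem integrable_compensatedCount (hN : IsMarkedHawkes P ℱ J₀ T μ φ τ ε J) (a : Fin 2)
    {B : Set ℝ} (hB : MeasurableSet B) {t : ℝ≥0} (ht : t ≤ T) (n : ℕ) :
    Integrable (fun ω => compensatedCount P J₀ T μ φ τ ε J a B (min t (τ n ω)) ω) P := by
  have := (hN.compensator a B hB n).integrable t
  simpa only [← min_assoc, min_eq_left ht, NNReal.coe_min] using this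

theorem integral_compensatedCount [IsFiniteMeasure P]
    (hN : IsMarkedHawkes P ℱ J₀ T μ φ τ ε J) (a : Fin 2)
    {B : Set ℝ} (hB : MeasurableSet B) {t : ℝ≥0} (ht : t ≤ T) (n : ℕ) :
    ∫ ω, compensatedCount P J₀ T μ φ τ ε J a B (min t (τ n ω)) ω ∂P = 0 := by
  -- The expectation is constant in time, and it vanishes at time 0 because every arrival is
  -- strictly positive.
  have h := (hN.compensator a B hB n).setIntegral_eq (zero_le (a := t)) MeasurableSet.univ
  have h0 : ∀ ω, compensatedCount P J₀ T μ φ τ ε J a B (0 : ℝ) ω = 0 := by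
    intro ω
    have hpos : ∀ i, ¬ ((τ i ω : ℝ) ≤ 0) := by
      intro i hi
      have h1 : τ 0 ω ≤ τ i ω := (hN.arrival_strictMono ω).monotone (Nat.zero_le i)
      have h2 : τ i ω ≤ 0 := by exact_mod_cast hi
      exact (hN.arrival_pos ω).not_ge (h1.trans h2)
    simp only [compensatedCount, markedCount, markedIntegral, hpos, false_and, if_false]
    simp
  simp only [← min_assoc, min_eq_left ht, min_eq_left (zero_le (a := T)), NNReal.coe_min,
    setIntegral_univ] at h
  rw [← h]
  simp [h0]

/-- The compensator stopped at an arrival time is integrable. -/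
theorem integrable_compensator [IsProbabilityMeasure P]
    (hN : IsMarkedHawkes P ℱ J₀ T μ φ τ ε J) (hJ₀ : Integrable J₀ P) (a : Fin 2) {t : ℝ≥0}
    (ht : t ≤ T) (n : ℕ) :
    Integrable (fun ω => ∫ s in (0 : ℝ)..(min t (τ n ω)), intensity T μ φ τ ε J a s ω) P := by
  have h1 := hN.integrable_compensatedCount a MeasurableSet.univ ht n
  have h2 := hN.integrable_markedCount_min a MeasurableSet.univ t n
  have : IsProbabilityMeasure (P.map J₀) := Measure.isProbabilityMeasure_map hJ₀.aemeasurable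
  -- With B the whole line, the compensator is the count, at most n + 1, minus the martingale.
  refine (h2.sub h1).congr (Filter.Eventually.of_forall fun ω => ?_)
  simp [compensatedCount]

theorem sum_measureReal_event_inter [IsProbabilityMeasure P]
    (hN : IsMarkedHawkes P ℱ J₀ T μ φ τ ε J) (hJ₀ : Integrable J₀ P) (a : Fin 2)
    {B : Set ℝ} (hB : MeasurableSet B) {t : ℝ≥0} (ht : t ≤ T) (n : ℕ) :
    ∑ i ∈ Finset.range (n + 1), P.real ({ω | (τ i ω : ℝ) ≤ t ∧ ε i ω = a} ∩ J i ⁻¹' B) =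
      (∫ ω, (∫ s in (0 : ℝ)..(min t (τ n ω)), intensity T μ φ τ ε J a s ω) ∂P) *
        (P.map J₀).real B := by
  have h := hN.integral_compensatedCount a hB ht n
  unfold compensatedCount at h
  rw [integral_sub (hN.integrable_markedCount_min a hB t n)
    ((hN.integrable_compensator hJ₀ a ht n).mul_const _), integral_mul_const,
    hN.integral_markedCount_min a hB] at h
  linarith

/-- The identity for all Borel B says that the expected mark measure of the first n + 1 events is a
multiple of the law of J₀; integrating x against both sides passes from counts to jump sizes. -/
theorem sum_integral_jumpTerm [IsProbabilityMeasure P]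
    (hN : IsMarkedHawkes P ℱ J₀ T μ φ τ ε J) (hJ₀ : Integrable J₀ P) (a : Fin 2)
    {t : ℝ≥0} (ht : t ≤ T) (n : ℕ) :
    ∑ i ∈ Finset.range (n + 1), ∫ ω, eventTerm τ ε J a (fun _ x => x) t i ω ∂P =
      (∫ ω, (∫ s in (0 : ℝ)..(min t (τ n ω)), intensity T μ φ τ ε J a s ω) ∂P) *
        ∫ ω, J₀ ω ∂P := by
  set L := ∫ ω, (∫ s in (0 : ℝ)..(min t (τ n ω)), intensity T μ φ τ ε J a s ω) ∂P with hL
  have hprob : IsProbabilityMeasure (P.map J₀) := Measure.isProbabilityMeasure_map hJ₀.aemeasurable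
  have hL0 : 0 ≤ L := by
    have h := hN.sum_measureReal_event_inter hJ₀ a MeasurableSet.univ ht n
    rw [probReal_univ, mul_one] at h
    rw [hL, ← h]
    exact Finset.sum_nonneg fun i _ => measureReal_nonneg
  set E : ℕ → Set Ω := fun i => {ω | (τ i ω : ℝ) ≤ t ∧ ε i ω = a}
  have hν : ∑ i ∈ Finset.range (n + 1), (P.restrict (E i)).map (J i) =
      ENNReal.ofReal L • P.map J₀ := by
    ext B hB
    have h := hN.sum_measureReal_event_inter hJ₀ a hB ht n
    have h1 : ∀ i, (P.restrict (E i)).map (J i) B = ENNReal.ofReal (P.real (E i ∩ J i ⁻¹' B)) := by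
      intro i
      rw [Measure.map_apply (hN.measurable_mark i) hB,
        Measure.restrict_apply (hN.measurable_mark i hB), ofReal_measureReal, Set.inter_comm]
    rw [Measure.finsetSum_apply]
    simp_rw [h1]
    rw [← ENNReal.ofReal_sum_of_nonneg fun i _ => measureReal_nonneg, h,
      ENNReal.ofReal_mul hL0, ofReal_measureReal]
    rfl
  have h1 : ∫ x, x ∂(P.map J₀) = ∫ ω, J₀ ω ∂P :=
    integral_map hJ₀.aemeasurable aestronglyMeasurable_id
  have h2 : ∀ i, ∫ x, x ∂((P.restrict (E i)).map (J i)) =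
      ∫ ω, eventTerm τ ε J a (fun _ x => x) t i ω ∂P := by
    intro i
    rw [integral_map (f := fun x => x) (hN.measurable_mark i).aemeasurable
      aestronglyMeasurable_id, ← integral_indicator (hN.measurableSet_event a t i)]
    simp [eventTerm, Set.indicator]
  have h3 := congrArg (fun ν : Measure ℝ => ∫ x, x ∂ν) hν
  rw [integral_finsetSum_measure, integral_smul_measure, h1] at h3
  · simpa [h2, hL0] using h3
  · intro i _
    exact (integrable_map_measure aestronglyMeasurable_id (hN.measurable_mark i).aemeasurable).2
      (hN.integrable_mark hJ₀ i).integrableOn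

end General

end IsMarkedHawkes

theorem summable_eventTerm {τ : ℕ → Ω → ℝ≥0} {ε : ℕ → Ω → Fin 2} {J : ℕ → Ω → ℝ} {ω : Ω}
    (hτ : StrictMono fun i => τ i ω) (b : Fin 2) (h : ℝ → ℝ → ℝ)
    {n : ℕ} {s : ℝ} (hs : s < τ n ω) :
    Summable fun i => eventTerm τ ε J b h s i ω := by
  refine (hasSum_sum_of_ne_finset_zero (s := Finset.range n) fun i hi => if_neg fun hh => ?_).summable
  have h1 : τ n ω ≤ τ i ω := hτ.monotone (by simpa using hi)
  have h2 : (τ n ω : ℝ) ≤ τ i ω := by exact_mod_cast h1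
  linarith [hh.1]

theorem abs_mul_exp_neg_le {β x r : ℝ} (hβ : 0 < β) (hx : 0 < x) (hr : 0 ≤ r) :
    |x * Real.exp (-β * r)| ≤ x := by
  rw [abs_of_pos (by positivity)]
  have : Real.exp (-β * r) ≤ 1 := Real.exp_le_one_iff.2 (by nlinarith)
  nlinarith

/-! ### Uniform bounds and non-explosion -/

namespace IsMarkedHawkes

variable {mΩ : MeasurableSpace Ω} {P : Measure Ω}
  {ℱ : Filtration ℝ≥0 mΩ} {J₀ : Ω → ℝ} {T : ℝ≥0} {τ : ℕ → Ω → ℝ≥0} {ε : ℕ → Ω → Fin 2}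
  {J : ℕ → Ω → ℝ} {μ₀ κ α β : ℝ}

/-- The factor 1 - e^{-β(t-u)} is replaced by 1 and the stopping in the baseline is dropped, which
leaves a bound by jump sums of the opposite type. -/
theorem compensator_le
    (hN : IsMarkedHawkes P ℱ J₀ T (expBaseline μ₀ κ) (expExcitation α β) τ ε J)
    (hμ₀ : 0 < μ₀) (hc : 0 < κ / T) (hα : 0 < α) (hβ : 0 < β) (a : Fin 2) (t : ℝ≥0) (n : ℕ)
    (ω : Ω) :
    ∫ s in (0 : ℝ)..(min t (τ n ω)),
        intensity T (expBaseline μ₀ κ) (expExcitation α β) τ ε J a s ω ≤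
      μ₀ * ((Real.exp (κ / T * t) - 1) / (κ / T)) + α / β * ∑ i ∈ Finset.range (n + 1),
        eventTerm τ ε J (a + 1) (fun _ x => x) t i ω := by
  have hmin : (0 : ℝ) ≤ min (t : ℝ) (τ n ω) := le_min t.2 (τ n ω).2
  rw [integral_intensity (hN.arrival_strictMono ω) T μ₀ κ α hc.ne' hβ.ne' a hmin (min_le_right _ _)]
  gcongr with i hi
  · exact min_le_left _ _
  · rw [← eventTerm_min (hN.arrival_strictMono ω) (a + 1) (fun _ x => x) t hi]
    refine eventTerm_le_eventTerm fun _ => ?_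
    have := hN.mark_pos i ω
    nlinarith [Real.exp_pos (-β * (min (t : ℝ) (τ n ω) - τ i ω))]

theorem compensator_nonneg
    (hN : IsMarkedHawkes P ℱ J₀ T (expBaseline μ₀ κ) (expExcitation α β) τ ε J)
    (hμ₀ : 0 < μ₀) (hc : 0 < κ / T) (hα : 0 < α) (hβ : 0 < β) (a : Fin 2) (t : ℝ≥0) (n : ℕ)
    (ω : Ω) :
    0 ≤ ∫ s in (0 : ℝ)..(min t (τ n ω)),
        intensity T (expBaseline μ₀ κ) (expExcitation α β) τ ε J a s ω := by
  have hmin : (0 : ℝ) ≤ min (t : ℝ) (τ n ω) := le_min t.2 (τ n ω).2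
  rw [integral_intensity (hN.arrival_strictMono ω) T μ₀ κ α hc.ne' hβ.ne' a hmin (min_le_right _ _)]
  have h1 : 1 ≤ Real.exp (κ / T * min (t : ℝ) (τ n ω)) := Real.one_le_exp (by positivity)
  have h2 : ∀ i, 0 ≤ eventTerm τ ε J (a + 1)
      (fun u x => x * (1 - Real.exp (-β * (min (t : ℝ) (τ n ω) - u))))
      (min (t : ℝ) (τ n ω)) i ω := fun i => eventTerm_nonneg fun h => by
    have : Real.exp (-β * (min (t : ℝ) (τ n ω) - τ i ω)) ≤ 1 :=
      Real.exp_le_one_iff.2 (by nlinarith)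
    exact mul_nonneg (hN.mark_pos i ω).le (by linarith)
  have h3 := Finset.sum_nonneg fun i (_ : i ∈ Finset.range (n + 1)) => h2 i
  have h4 : 0 ≤ Real.exp (κ / T * min (t : ℝ) (τ n ω)) - 1 := by linarith
  positivity

variable [IsProbabilityMeasure P]

/-- A bound on the expected stopped compensator which is uniform in the stopping index. -/
theorem integral_compensator_le
    (hN : IsMarkedHawkes P ℱ J₀ T (expBaseline μ₀ κ) (expExcitation α β) τ ε J)
    (hJ₀ : Integrable J₀ P) (hμ₀ : 0 < μ₀) (hc : 0 < κ / T) (hα : 0 < α) (hβ : 0 < β)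
    (hstab : α * (∫ ω, J₀ ω ∂P) < β) (a : Fin 2) {t : ℝ≥0} (ht : t ≤ T) (n : ℕ) :
    ∫ ω, (∫ s in (0 : ℝ)..(min t (τ n ω)),
        intensity T (expBaseline μ₀ κ) (expExcitation α β) τ ε J a s ω) ∂P ≤
      μ₀ * ((Real.exp (κ / T * t) - 1) / (κ / T)) / (1 - α / β * ∫ ω, J₀ ω ∂P) := by
  set M := μ₀ * ((Real.exp (κ / T * t) - 1) / (κ / T))
  set L : Fin 2 → ℝ := fun a => ∫ ω, (∫ s in (0 : ℝ)..(min t (τ n ω)),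
        intensity T (expBaseline μ₀ κ) (expExcitation α β) τ ε J a s ω) ∂P with hL
  set ρ := α / β * ∫ ω, J₀ ω ∂P with hρ
  have hm := hN.integral_mark_nonneg
  have hρ0 : 0 ≤ ρ := by positivity
  have hρ1 : ρ < 1 := by
    rw [hρ, div_mul_eq_mul_div, div_lt_one hβ]
    exact hstab
  have key : ∀ a, L a ≤ M + ρ * L (a + 1) := by
    intro a
    have h1 := hN.sum_integral_jumpTerm hJ₀ (a + 1) ht n
    have hint : Integrable (fun ω => α / β * ∑ i ∈ Finset.range (n + 1),
        eventTerm τ ε J (a + 1) (fun _ x => x) t i ω) P :=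
      (integrable_finsetSum _ fun i _ => hN.integrable_jumpTerm hJ₀ (a + 1) t i).const_mul _
    have h2 : L a ≤ ∫ ω, (M + α / β * ∑ i ∈ Finset.range (n + 1),
        eventTerm τ ε J (a + 1) (fun _ x => x) t i ω) ∂P :=
      integral_mono (hN.integrable_compensator hJ₀ a ht n) ((integrable_const _).add hint)
        fun ω => hN.compensator_le hμ₀ hc hα hβ a t n ω
    rw [integral_add (integrable_const _) hint, integral_const_mul (α / β), integral_finsetSum _
      (fun i _ => hN.integrable_jumpTerm hJ₀ (a + 1) t i), h1] at h2
    simp only [integral_const, probReal_univ, one_smul] at h2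
    refine h2.trans_eq ?_
    simp only [hL, hρ]
    ring
  have h1 := key a
  have h2 := key (a + 1)
  have h3 : a + 1 + 1 = a := by fin_cases a <;> rfl
  rw [h3] at h2
  change L a ≤ M / (1 - ρ)
  rw [le_div_iff₀ (by linarith)]
  -- Using the estimate for both types gives (1 - ρ²) L ≤ (1 + ρ) M. Absorbing L is legitimate
  -- because it is a finite real for fixed n.
  have h4 : L a ≤ M + ρ * (M + ρ * L a) := h1.trans (by gcongr)
  have h5 : (1 + ρ) * (L a * (1 - ρ)) ≤ (1 + ρ) * M := by nlinarith
  exact le_of_mul_le_mul_left h5 (by linarith)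

/-- Almost surely, only finitely many events arrive on `[0, T]`. -/
theorem ae_exists_lt_arrival
    (hN : IsMarkedHawkes P ℱ J₀ T (expBaseline μ₀ κ) (expExcitation α β) τ ε J)
    (hJ₀ : Integrable J₀ P) (hμ₀ : 0 < μ₀) (hc : 0 < κ / T) (hα : 0 < α) (hβ : 0 < β)
    (hstab : α * (∫ ω, J₀ ω ∂P) < β) : ∀ᵐ ω ∂P, ∃ n, T < τ n ω := by
  set C := μ₀ * ((Real.exp (κ / T * T) - 1) / (κ / T)) / (1 - α / β * ∫ ω, J₀ ω ∂P)
  have hprob : IsProbabilityMeasure (P.map J₀) := Measure.isProbabilityMeasure_map hJ₀.aemeasurable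
  have hbound : ∀ a n, ∑ i ∈ Finset.range (n + 1), P.real {ω | (τ i ω : ℝ) ≤ T ∧ ε i ω = a} ≤ C := by
    intro a n
    have h := hN.sum_measureReal_event_inter hJ₀ a MeasurableSet.univ (le_refl T) n
    simp only [Set.preimage_univ, Set.inter_univ, probReal_univ, mul_one] at h
    rw [h]
    exact hN.integral_compensator_le hJ₀ hμ₀ hc hα hβ hstab a le_rfl n
  have hle : ∀ i, P.real {ω | (τ i ω : ℝ) ≤ T} ≤
      P.real {ω | (τ i ω : ℝ) ≤ T ∧ ε i ω = 0} + P.real {ω | (τ i ω : ℝ) ≤ T ∧ ε i ω = 1} := by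
    intro i
    refine (measureReal_mono ?_).trans (measureReal_union_le _ _)
    intro ω hω
    have : ε i ω = 0 ∨ ε i ω = 1 := by
      generalize ε i ω = e
      fin_cases e <;> simp
    rcases this with h | h
    exacts [Or.inl ⟨hω, h⟩, Or.inr ⟨hω, h⟩]
  have hsum : Summable fun i => P.real {ω | (τ i ω : ℝ) ≤ T} := by
    refine summable_of_sum_range_le (c := C + C) (fun _ => measureReal_nonneg) fun n => ?_
    calc _ ≤ ∑ i ∈ Finset.range (n + 1), P.real {ω | (τ i ω : ℝ) ≤ T} :=
          Finset.sum_le_sum_of_subset_of_nonneg (Finset.range_mono n.le_succ)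
            fun _ _ _ => measureReal_nonneg
      _ ≤ _ := Finset.sum_le_sum fun i _ => hle i
      _ ≤ _ := by
          rw [Finset.sum_add_distrib]
          exact add_le_add (hbound 0 n) (hbound 1 n)
  have htop : ∑' i, P {ω | (τ i ω : ℝ) ≤ T} ≠ ⊤ := by
    have := hsum.tsum_ofReal_ne_top
    rwa [tsum_congr fun i => ofReal_measureReal] at this
  -- First Borel–Cantelli lemma: almost surely only finitely many τ_i are at most T.
  filter_upwards [ae_finite_setOfPred_mem htop] with ω hω
  obtain ⟨n, hn⟩ := hω.exists_notMem
  refine ⟨n, ?_⟩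
  have h : ¬ ((τ n ω : ℝ) ≤ T) := hn
  rw [not_le] at h
  exact_mod_cast h

/-! ### Integrability on [0, T] and removal of the localization -/

section Moments

variable (hN : IsMarkedHawkes P ℱ J₀ T (expBaseline μ₀ κ) (expExcitation α β) τ ε J)
  (hJ₀ : Integrable J₀ P) (hμ₀ : 0 < μ₀) (hc : 0 < κ / T) (hα : 0 < α) (hβ : 0 < β)
  (hstab : α * (∫ ω, J₀ ω ∂P) < β)

include hN hJ₀ hμ₀ hc hα hβ hstab

/-- The partial sums are m times expected stopped compensators, bounded uniformly in n. This series
dominates every other one used below. -/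
theorem summable_integral_jumpTerm (a : Fin 2) {t : ℝ≥0} (ht : t ≤ T) :
    Summable fun i => ∫ ω, eventTerm τ ε J a (fun _ x => x) t i ω ∂P := by
  have h0 : ∀ i, 0 ≤ ∫ ω, eventTerm τ ε J a (fun _ x => x) t i ω ∂P :=
    fun i => integral_nonneg fun ω => hN.jumpTerm_nonneg a t i ω
  refine summable_of_sum_range_le h0 (c := μ₀ * ((Real.exp (κ / T * t) - 1) / (κ / T)) /
    (1 - α / β * ∫ ω, J₀ ω ∂P) * ∫ ω, J₀ ω ∂P) fun n => ?_
  calc _ ≤ ∑ i ∈ Finset.range (n + 1), ∫ ω, eventTerm τ ε J a (fun _ x => x) t i ω ∂P :=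
        Finset.sum_le_sum_of_subset_of_nonneg (Finset.range_mono n.le_succ) fun i _ _ => h0 i
    _ ≤ _ := by
        rw [hN.sum_integral_jumpTerm hJ₀ a ht n]
        exact mul_le_mul_of_nonneg_right
          (hN.integral_compensator_le hJ₀ hμ₀ hc hα hβ hstab a ht n) hN.integral_mark_nonneg

theorem summable_integral_norm_eventTerm (a : Fin 2) {h : ℝ → ℝ → ℝ}
    (hh : Measurable fun p : ℝ × ℝ => h p.1 p.2) {t : ℝ≥0} (ht : t ≤ T)
    (hle : ∀ u ≤ (t : ℝ), ∀ x, 0 < x → |h u x| ≤ x) :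
    Summable fun i => ∫ ω, ‖eventTerm τ ε J a h t i ω‖ ∂P := by
  refine (hN.summable_integral_jumpTerm hJ₀ hμ₀ hc hα hβ hstab a ht).of_nonneg_of_le
    (fun i => integral_nonneg fun ω => norm_nonneg _) fun i =>
      integral_mono (hN.integrable_eventTerm hJ₀ a hh hle i).norm
        (hN.integrable_jumpTerm hJ₀ a t i) fun ω => ?_
  unfold eventTerm
  simp only
  split_ifs with h1
  · exact hle _ h1.1 _ (hN.mark_pos i ω)
  · simp

theorem integrable_markedIntegral (a : Fin 2) {h : ℝ → ℝ → ℝ}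
    (hh : Measurable fun p : ℝ × ℝ => h p.1 p.2) {t : ℝ≥0} (ht : t ≤ T)
    (hle : ∀ u ≤ (t : ℝ), ∀ x, 0 < x → |h u x| ≤ x) :
    Integrable (markedIntegral τ ε J a h t) P :=
  integrable_tsum_of_summable_integral_norm (fun i => hN.integrable_eventTerm hJ₀ a hh hle i)
    (hN.summable_integral_norm_eventTerm hJ₀ hμ₀ hc hα hβ hstab a hh ht hle)

theorem hasSum_integral_eventTerm (a : Fin 2) {h : ℝ → ℝ → ℝ}
    (hh : Measurable fun p : ℝ × ℝ => h p.1 p.2) {t : ℝ≥0} (ht : t ≤ T)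
    (hle : ∀ u ≤ (t : ℝ), ∀ x, 0 < x → |h u x| ≤ x) :
    HasSum (fun i => ∫ ω, eventTerm τ ε J a h t i ω ∂P) (∫ ω, markedIntegral τ ε J a h t ω ∂P) :=
  hasSum_integral_of_summable_integral_norm (fun i => hN.integrable_eventTerm hJ₀ a hh hle i)
    (hN.summable_integral_norm_eventTerm hJ₀ hμ₀ hc hα hβ hstab a hh ht hle)

theorem integrable_jumpSum (a : Fin 2) {t : ℝ≥0} (ht : t ≤ T) :
    Integrable (jumpSum τ ε J a t) P :=
  hN.integrable_markedIntegral hJ₀ hμ₀ hc hα hβ hstab a measurable_snd ht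
    fun _ _ _ hx => (abs_of_pos hx).le

theorem integrable_discountedSum (a : Fin 2) {t : ℝ≥0} (ht : t ≤ T) :
    Integrable (discountedSum β τ ε J a t) P :=
  hN.integrable_markedIntegral hJ₀ hμ₀ hc hα hβ hstab a
    (h := fun s x => x * Real.exp (-β * (t - s))) (by fun_prop) ht
    fun _ hu _ hx => abs_mul_exp_neg_le hβ hx (sub_nonneg.2 hu)

/-- This is E f^a_t = m E ∫_0^t λ^a, the limit n → ∞ of `sum_integral_jumpTerm`, with the time
integral of the intensity already evaluated pathwise. -/
theorem integral_jumpSum_eq_compensator (a : Fin 2) {t : ℝ≥0} (ht : t ≤ T) :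
    ∫ ω, jumpSum τ ε J a t ω ∂P = (∫ ω, J₀ ω ∂P) *
      (μ₀ * ((Real.exp (κ / T * t) - 1) / (κ / T)) + α / β *
        (∫ ω, jumpSum τ ε J (a + 1) t ω ∂P - ∫ ω, discountedSum β τ ε J (a + 1) t ω ∂P)) := by
  have hlim1 : Filter.Tendsto (fun n => ∑ i ∈ Finset.range (n + 1),
      ∫ ω, eventTerm τ ε J a (fun _ x => x) t i ω ∂P) Filter.atTop
      (nhds (∫ ω, jumpSum τ ε J a t ω ∂P)) :=
    (hN.hasSum_integral_eventTerm hJ₀ hμ₀ hc hα hβ hstab a (h := fun _ x => x) measurable_snd ht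
      fun _ _ _ hx => (abs_of_pos hx).le).tendsto_sum_nat.comp (Filter.tendsto_add_atTop_nat 1)
  have hif := hN.integrable_jumpSum hJ₀ hμ₀ hc hα hβ hstab (a + 1) ht
  have hig := hN.integrable_discountedSum hJ₀ hμ₀ hc hα hβ hstab (a + 1) ht
  have hlim2 : Filter.Tendsto (fun n => ∫ ω, (∫ s in (0 : ℝ)..(min t (τ n ω)),
        intensity T (expBaseline μ₀ κ) (expExcitation α β) τ ε J a s ω) ∂P) Filter.atTop
      (nhds (∫ ω, (μ₀ * ((Real.exp (κ / T * t) - 1) / (κ / T)) + α / β *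
        (jumpSum τ ε J (a + 1) t ω - discountedSum β τ ε J (a + 1) t ω)) ∂P)) := by
    -- The dominating function is the limit of the bounds in `compensator_le`, integrable by
    -- `integrable_jumpSum`. By non-explosion the sequence is eventually constant in n along almost
    -- every path.
    refine tendsto_integral_of_dominated_convergence
      (fun ω => μ₀ * ((Real.exp (κ / T * t) - 1) / (κ / T)) + α / β * jumpSum τ ε J (a + 1) t ω)
      (fun n => (hN.integrable_compensator hJ₀ a ht n).aestronglyMeasurable)
      ((integrable_const _).add (hif.const_mul _)) (fun n => ?_) ?_
    · filter_upwards [hN.ae_exists_lt_arrival hJ₀ hμ₀ hc hα hβ hstab] with ω hω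
      obtain ⟨N, hN'⟩ := hω
      have htN : (t : ℝ) < τ N ω := by exact_mod_cast ht.trans_lt hN'
      rw [Real.norm_eq_abs, abs_of_nonneg (hN.compensator_nonneg hμ₀ hc hα hβ a t n ω)]
      refine (hN.compensator_le hμ₀ hc hα hβ a t n ω).trans ?_
      gcongr
      exact (summable_eventTerm (hN.arrival_strictMono ω) _ _ htN).sum_le_tsum _
        fun i _ => hN.jumpTerm_nonneg _ _ i ω
    · filter_upwards [hN.ae_exists_lt_arrival hJ₀ hμ₀ hc hα hβ hstab] with ω hω
      obtain ⟨N, hN'⟩ := hω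
      refine tendsto_const_nhds.congr' ?_
      filter_upwards [Filter.eventually_ge_atTop N] with n hn
      have h1 : τ N ω ≤ τ n ω := (hN.arrival_strictMono ω).monotone hn
      have h2 : (t : ℝ) ≤ τ n ω := by exact_mod_cast (ht.trans_lt hN').le.trans h1
      rw [min_eq_left h2, integral_intensity (hN.arrival_strictMono ω) T μ₀ κ α hc.ne'
          hβ.ne' a (NNReal.coe_nonneg t) h2,
        jumpSum, discountedSum, markedIntegral_eq_sum (hN.arrival_strictMono ω) _ _ h2,
        markedIntegral_eq_sum (hN.arrival_strictMono ω) _ _ h2, ← Finset.sum_sub_distrib]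
      congr 2
      refine Finset.sum_congr rfl fun i _ => ?_
      unfold eventTerm
      split_ifs
      · ring
      · simp
  have h := tendsto_nhds_unique hlim1 (by
    simp_rw [hN.sum_integral_jumpTerm hJ₀ a ht]
    exact hlim2.mul_const _)
  have hsub : Integrable (fun ω => jumpSum τ ε J (a + 1) t ω - discountedSum β τ ε J (a + 1) t ω) P :=
    hif.sub hig
  rw [h, integral_add (integrable_const _) (hsub.const_mul _), integral_const_mul (α / β),
    integral_sub hif hig]
  simp
  ring

end Moments

end IsMarkedHawkes

/-! ### The deterministic Volterra system -/

/-- Uniqueness for the linear Volterra equation `u t = r * ∫ s in 0..t, u s`. -/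
theorem eq_zero_of_eq_const_mul_integral {u : ℝ → ℝ} {r T : ℝ}
    (hu : IntervalIntegrable u volume 0 T)
    (h : ∀ t ∈ Set.Icc 0 T, u t = r * ∫ s in (0 : ℝ)..t, u s) : ∀ t ∈ Set.Icc 0 T, u t = 0 := by
  intro t ht
  have hT : 0 ≤ T := ht.1.trans ht.2
  have hK : ContinuousOn (fun t => ∫ s in (0 : ℝ)..t, u s) (Set.Icc 0 T) := by
    rw [← Set.uIcc_of_le hT]
    refine intervalIntegral.continuousOn_primitive_interval ?_
    rw [Set.uIcc_of_le hT, integrableOn_Icc_iff_integrableOn_Ioc]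
    exact (intervalIntegrable_iff_integrableOn_Ioc_of_le hT).1 hu
  -- The equation upgrades integrability to continuity, so the primitive K has right derivative u =
  -- rK and Grönwall forces K = 0.
  have hcont : ContinuousOn u (Set.Icc 0 T) := (hK.const_smul r).congr h
  have hder : ∀ x ∈ Set.Ico 0 T,
      HasDerivWithinAt (fun t => ∫ s in (0 : ℝ)..t, u s) (u x) (Set.Ici x) x := by
    intro x hx
    have hmem : Set.Icc 0 T ∈ nhdsWithin x (Set.Ioi x) :=
      Filter.mem_of_superset (Ioc_mem_nhdsGT hx.2)
        fun y hy => ⟨hx.1.trans hy.1.le, hy.2⟩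
    refine intervalIntegral.integral_hasDerivWithinAt_right (t := Set.Ioi x)
      (hu.mono_set ?_) ?_ ?_
    · rw [Set.uIcc_of_le hx.1, Set.uIcc_of_le hT]
      exact Set.Icc_subset_Icc_right hx.2.le
    · exact ⟨_, hmem, hcont.aestronglyMeasurable measurableSet_Icc⟩
    · exact (hcont x ⟨hx.1, hx.2.le⟩).mono_of_mem_nhdsWithin hmem
  rw [h t ht, eq_zero_of_abs_deriv_le_mul_abs_self_of_eq_zero_right hK hder (K := |r|)
    intervalIntegral.integral_same (fun x hx => ?_) t ht, mul_zero]
  rw [h x ⟨hx.1, hx.2.le⟩, norm_mul, Real.norm_eq_abs r]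

/-- The linear system satisfied by the expected discounted sums has an explicit solution. -/
theorem eq_explicit_of_integral_system {G : Fin 2 → ℝ → ℝ} {T μ₀ m c α β : ℝ} (hc : 0 < c)
    (hr : 0 < β - α * m) (hG : ∀ a, IntervalIntegrable (G a) volume 0 T)
    (h : ∀ a, ∀ t ∈ Set.Icc 0 T, G a t = m * (μ₀ * ((Real.exp (c * t) - 1) / c) +
      α * ∫ s in (0 : ℝ)..t, G (a + 1) s) - β * ∫ s in (0 : ℝ)..t, G a s)
    (a : Fin 2) {t : ℝ} (ht : t ∈ Set.Icc 0 T) :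
    G a t = μ₀ * m / (β - α * m + c) * (Real.exp (c * t) - Real.exp (-(β - α * m) * t)) ∧
    ∫ s in (0 : ℝ)..t, G a s = μ₀ * m / (β - α * m + c) *
      ((Real.exp (c * t) - 1) / c + (Real.exp (-(β - α * m) * t) - 1) / (β - α * m)) := by
  have hT : 0 ≤ T := ht.1.trans ht.2
  have hGt : ∀ a, ∀ t ∈ Set.Icc 0 T, IntervalIntegrable (G a) volume 0 t := fun a t ht =>
    (hG a).mono_set (by
      rw [Set.uIcc_of_le ht.1, Set.uIcc_of_le hT]
      exact Set.Icc_subset_Icc_right ht.2)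
  -- The inhomogeneous terms cancel in the difference of the two equations.
  have hsymm : ∀ t ∈ Set.Icc 0 T, G a t - G (a + 1) t = 0 := by
    refine eq_zero_of_eq_const_mul_integral (r := -(m * α + β)) ((hG a).sub (hG (a + 1))) ?_
    intro t ht
    have h3 : a + 1 + 1 = a := by fin_cases a <;> rfl
    rw [intervalIntegral.integral_sub (hGt a t ht) (hGt (a + 1) t ht), h a t ht, h (a + 1) t ht, h3]
    ring
  have hK : ∀ t ∈ Set.Icc 0 T, ∫ s in (0 : ℝ)..t, G (a + 1) s = ∫ s in (0 : ℝ)..t, G a s := by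
    intro t ht
    refine intervalIntegral.integral_congr fun s hs => ?_
    rw [Set.uIcc_of_le ht.1] at hs
    exact (sub_eq_zero.1 (hsymm s ⟨hs.1, hs.2.trans ht.2⟩)).symm
  -- With G_0 = G_1 the system becomes y' = m μ₀ e^{ct} - (β - αm) y, y(0) = 0, whose solution is g.
  set g : ℝ → ℝ := fun t =>
    μ₀ * m / (β - α * m + c) * (Real.exp (c * t) - Real.exp (-(β - α * m) * t)) with hg
  have hgc : Continuous g := by fun_prop
  have hgint : ∀ t, ∫ s in (0 : ℝ)..t, g s = μ₀ * m / (β - α * m + c) *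
      ((Real.exp (c * t) - 1) / c + (Real.exp (-(β - α * m) * t) - 1) / (β - α * m)) := by
    intro t
    have h1 := integral_exp_linear hc.ne' 0 t 0
    have h2 := integral_exp_linear (neg_ne_zero.2 hr.ne') 0 t 0
    simp only [sub_zero, mul_zero, Real.exp_zero] at h1 h2
    rw [hg, intervalIntegral.integral_const_mul, intervalIntegral.integral_sub
      (by apply Continuous.intervalIntegrable; fun_prop)
      (by apply Continuous.intervalIntegrable; fun_prop), h1, h2, div_neg]
    ring
  have heq : ∀ t ∈ Set.Icc 0 T, G a t - g t = 0 := by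
    refine eq_zero_of_eq_const_mul_integral (r := -(β - α * m))
      ((hG a).sub (hgc.intervalIntegrable _ _)) ?_
    intro t ht
    rw [intervalIntegral.integral_sub (hGt a t ht) (hgc.intervalIntegrable _ _), h a t ht, hK t ht,
      hgint]
    simp only [hg]
    have hr0 : β - α * m ≠ 0 := hr.ne'
    have hrc : β - α * m + c ≠ 0 := by positivity
    generalize Real.exp (-(β - α * m) * t) = y, Real.exp (c * t) = x
    generalize hR : β - α * m = r at hr0 hrc ⊢
    -- Eliminating β makes the denominators c, r and r + c, with r a single variable.
    obtain rfl : β = r + α * m := by linarith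
    field_simp
    ring
  refine ⟨sub_eq_zero.1 (heq t ht), ?_⟩
  rw [← hgint]
  refine intervalIntegral.integral_congr fun s hs => ?_
  rw [Set.uIcc_of_le ht.1] at hs
  exact sub_eq_zero.1 (heq s ⟨hs.1, hs.2.trans ht.2⟩)

/-! ### Fubini and the closed system for the expectations -/

namespace IsMarkedHawkes

variable {mΩ : MeasurableSpace Ω} {P : Measure Ω} [IsProbabilityMeasure P]
  {ℱ : Filtration ℝ≥0 mΩ} {J₀ : Ω → ℝ} {T : ℝ≥0} {τ : ℕ → Ω → ℝ≥0} {ε : ℕ → Ω → Fin 2}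
  {J : ℕ → Ω → ℝ} {μ₀ κ α β : ℝ}

theorem integrable_uncurry_discountTerm {μ : ℝ → ℝ} {φ : ℝ → Matrix (Fin 2) (Fin 2) ℝ}
    (hN : IsMarkedHawkes P ℱ J₀ T μ φ τ ε J) (hJ₀ : Integrable J₀ P) (hβ : 0 < β) (a : Fin 2)
    (t : ℝ) (i : ℕ) :
    Integrable (Function.uncurry fun (u : ℝ) ω =>
      eventTerm τ ε J a (fun s x => x * Real.exp (-β * (u - s))) u i ω)
      ((volume.restrict (Set.Ioc 0 t)).prod P) := by
  refine ((hN.integrable_mark hJ₀ i).comp_snd (volume.restrict (Set.Ioc 0 t))).mono'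
    (measurable_uncurry_eventTerm (hN.measurable_arrival i) (hN.measurable_type i)
      (hN.measurable_mark i) a (h := fun u s x => x * Real.exp (-β * (u - s)))
      (by fun_prop)).aestronglyMeasurable (Filter.Eventually.of_forall fun p => ?_)
  simp only [Function.uncurry, eventTerm]
  split_ifs with h1
  · exact abs_mul_exp_neg_le hβ (hN.mark_pos i p.2) (sub_nonneg.2 h1.1)
  · simpa using (hN.mark_pos i p.2).le

/-- Fubini for one event at a time, with J_i as dominating function, followed by the pathwise time
integral. -/
theorem integral_integral_discountTerm {μ : ℝ → ℝ} {φ : ℝ → Matrix (Fin 2) (Fin 2) ℝ}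
    (hN : IsMarkedHawkes P ℱ J₀ T μ φ τ ε J) (hJ₀ : Integrable J₀ P) (hβ : 0 < β) (a : Fin 2)
    (t : ℝ≥0) (i : ℕ) :
    ∫ u in Set.Ioc (0 : ℝ) t, ∫ ω,
        eventTerm τ ε J a (fun s x => x * Real.exp (-β * (u - s))) u i ω ∂P =
      (∫ ω, eventTerm τ ε J a (fun _ x => x) t i ω ∂P -
        ∫ ω, eventTerm τ ε J a (fun s x => x * Real.exp (-β * (t - s))) t i ω ∂P) / β := by
  rw [integral_integral_swap (hN.integrable_uncurry_discountTerm hJ₀ hβ a t i),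
    ← integral_sub (hN.integrable_jumpTerm hJ₀ a t i)
      (hN.integrable_eventTerm hJ₀ a (h := fun s x => x * Real.exp (-β * (t - s))) (by fun_prop)
        (fun _ hu _ hx => abs_mul_exp_neg_le hβ hx (sub_nonneg.2 hu)) i), ← integral_div]
  congr 1
  ext ω
  rw [← intervalIntegral.integral_of_le (NNReal.coe_nonneg t)]
  refine (integral_eventTerm hβ.ne' a i ω (NNReal.coe_nonneg t)).trans ?_
  unfold eventTerm
  split_ifs
  · ring
  · simp

section Moments

variable (hN : IsMarkedHawkes P ℱ J₀ T (expBaseline μ₀ κ) (expExcitation α β) τ ε J)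
  (hJ₀ : Integrable J₀ P) (hμ₀ : 0 < μ₀) (hc : 0 < κ / T) (hα : 0 < α) (hβ : 0 < β)
  (hstab : α * (∫ ω, J₀ ω ∂P) < β)

include hN hJ₀ hμ₀ hc hα hβ hstab

/-- Expectation of f = D + β ∫ D. The terms are nonnegative, so summability of their time integrals
gives both the integrability in u and the exchange of sum and integral. -/
theorem intervalIntegrable_and_integral_discountedSum (a : Fin 2) {t : ℝ≥0} (ht : t ≤ T) :
    IntervalIntegrable (fun u => ∫ ω, discountedSum β τ ε J a u ω ∂P) volume 0 t ∧
    ∫ u in (0 : ℝ)..t, (∫ ω, discountedSum β τ ε J a u ω ∂P) =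
      (∫ ω, jumpSum τ ε J a t ω ∂P - ∫ ω, discountedSum β τ ε J a t ω ∂P) / β := by
  have hsum1 : HasSum (fun i => ∫ ω, eventTerm τ ε J a (fun _ x => x) t i ω ∂P)
      (∫ ω, jumpSum τ ε J a t ω ∂P) :=
    hN.hasSum_integral_eventTerm hJ₀ hμ₀ hc hα hβ hstab a (h := fun _ x => x) measurable_snd ht
      fun _ _ _ hx => (abs_of_pos hx).le
  have hsum2 : ∀ u : ℝ≥0, u ≤ T → HasSum
      (fun i => ∫ ω, eventTerm τ ε J a (fun s x => x * Real.exp (-β * (u - s))) u i ω ∂P)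
      (∫ ω, discountedSum β τ ε J a u ω ∂P) := fun u hu =>
    hN.hasSum_integral_eventTerm hJ₀ hμ₀ hc hα hβ hstab a
      (h := fun s x => x * Real.exp (-β * (u - s))) (by fun_prop) hu
      fun _ hu _ hx => abs_mul_exp_neg_le hβ hx (sub_nonneg.2 hu)
  set Gi : ℕ → ℝ → ℝ := fun i u =>
    ∫ ω, eventTerm τ ε J a (fun s x => x * Real.exp (-β * (u - s))) u i ω ∂P with hGi
  have hint : ∀ i, Integrable (Gi i) (volume.restrict (Set.Ioc 0 (t : ℝ))) := fun i =>
    (hN.integrable_uncurry_discountTerm hJ₀ hβ a t i).integral_prod_left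
  have hnorm : ∀ i u, ‖Gi i u‖ = Gi i u := fun i u => by
    rw [Real.norm_eq_abs]
    exact abs_of_nonneg (integral_nonneg fun ω => eventTerm_nonneg fun _ =>
      mul_nonneg (hN.mark_pos i ω).le (Real.exp_pos _).le)
  have hval : HasSum (fun i => ∫ u in Set.Ioc (0 : ℝ) t, Gi i u)
      ((∫ ω, jumpSum τ ε J a t ω ∂P - ∫ ω, discountedSum β τ ε J a t ω ∂P) / β) := by
    simp only [hGi, hN.integral_integral_discountTerm hJ₀ hβ a t]
    exact (hsum1.sub (hsum2 t ht)).div_const β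
  have hs : Summable fun i => ∫ u in Set.Ioc (0 : ℝ) t, ‖Gi i u‖ := by
    simp_rw [hnorm]
    exact hval.summable
  have hG : Set.EqOn (fun u => ∑' i, Gi i u) (fun u => ∫ ω, discountedSum β τ ε J a u ω ∂P)
      (Set.Ioc 0 (t : ℝ)) := fun u hu => by
    lift u to ℝ≥0 using hu.1.le
    exact (hsum2 u ((by exact_mod_cast hu.2 : u ≤ t).trans ht)).tsum_eq
  constructor
  · rw [intervalIntegrable_iff_integrableOn_Ioc_of_le (NNReal.coe_nonneg t)]
    exact IntegrableOn.congr_fun (integrable_tsum_of_summable_integral_norm hint hs) hG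
      measurableSet_Ioc
  · rw [intervalIntegral.integral_of_le (NNReal.coe_nonneg t), ← setIntegral_congr_fun measurableSet_Ioc hG]
    exact (hasSum_integral_of_summable_integral_norm hint hs).unique hval

theorem integral_discountedSum_and_jumpSum (a : Fin 2) {t : ℝ≥0} (ht : t ≤ T) {m c : ℝ}
    (hm : m = ∫ ω, J₀ ω ∂P) (hc' : c = κ / T) :
    ∫ ω, discountedSum β τ ε J a t ω ∂P =
      μ₀ * m / (β - α * m + c) * (Real.exp (c * t) - Real.exp (-(β - α * m) * t)) ∧
    ∫ ω, jumpSum τ ε J a t ω ∂P = m * (μ₀ * ((Real.exp (c * t) - 1) / c) + α *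
      (μ₀ * m / (β - α * m + c) *
        ((Real.exp (c * t) - 1) / c + (Real.exp (-(β - α * m) * t) - 1) / (β - α * m)))) := by
  -- The difference E f - E D is traded for β times a time integral, so that only the discounted
  -- expectations remain as unknowns.
  have hrel : ∀ (a : Fin 2) (t : ℝ≥0), t ≤ T → ∫ ω, jumpSum τ ε J a t ω ∂P =
      m * (μ₀ * ((Real.exp (c * t) - 1) / c) +
        α * ∫ u in (0 : ℝ)..t, ∫ ω, discountedSum β τ ε J (a + 1) u ω ∂P) := by
    intro a t ht
    rw [hN.integral_jumpSum_eq_compensator hJ₀ hμ₀ hc hα hβ hstab a ht,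
      (hN.intervalIntegrable_and_integral_discountedSum hJ₀ hμ₀ hc hα hβ hstab (a + 1) ht).2,
      ← hm, ← hc']
    ring
  have hsys := fun b : Fin 2 => eq_explicit_of_integral_system
    (G := fun a u => ∫ ω, discountedSum β τ ε J a u ω ∂P) (T := T) (μ₀ := μ₀) (m := m) (c := c)
    (α := α) (β := β) (hc'.symm ▸ hc) (sub_pos.2 (hm.symm ▸ hstab))
    (fun a => (hN.intervalIntegrable_and_integral_discountedSum hJ₀ hμ₀ hc hα hβ hstab a le_rfl).1)
    (fun a s hs => by
      lift s to ℝ≥0 using hs.1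
      have hsT : s ≤ T := by exact_mod_cast hs.2
      have h1 := (hN.intervalIntegrable_and_integral_discountedSum hJ₀ hμ₀ hc hα hβ hstab a hsT).2
      have h2 := hrel a s hsT
      rw [eq_div_iff hβ.ne'] at h1
      linarith) b (t := t) ⟨t.2, by exact_mod_cast ht⟩
  exact ⟨(hsys a).1, by rw [hrel a t ht, (hsys (a + 1)).2]⟩

end Moments

end IsMarkedHawkes

end MarkedHawkes

/-! ### The expectation formulas and the growth of market activity -/

open MarkedHawkes in
theorem proposition3p1 {Ω : Type*} {mΩ : MeasurableSpace Ω} (P : Measure Ω)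
    [IsProbabilityMeasure P] (ℱ : Filtration ℝ≥0 mΩ) (J₀ : Ω → ℝ) (hJ₀ : MemLp J₀ 2 P)
    (T : ℝ≥0) (hT : 0 < T) (μ₀ κ α β : ℝ) (hμ₀ : 0 < μ₀) (hκ : 0 < κ) (hα : 0 < α) (hβ : 0 < β)
    (hstab : α * (∫ ω, J₀ ω ∂P) < β)
    (τ : ℕ → Ω → ℝ≥0) (ε : ℕ → Ω → Fin 2) (J : ℕ → Ω → ℝ)
    (hN : IsMarkedHawkes P ℱ J₀ T (expBaseline μ₀ κ) (expExcitation α β) τ ε J)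
    (m c : ℝ) (hm : m = ∫ ω, J₀ ω ∂P) (hc : c = κ / T) :
    -- the expectations of `f^+_t` and `f^-_t`
    (∀ (a : Fin 2), ∀ t ∈ Set.Icc (0 : ℝ) T,
      Integrable (jumpSum τ ε J a t) P ∧
      ∫ ω, jumpSum τ ε J a t ω ∂P =
        μ₀ * m * ((β + c) / (c * (β - α * m + c)) * Real.exp (κ * (t / T))
          + α * m / ((β - α * m) * (β - α * m + c)) * Real.exp (-(β - α * m) * t)
          - β / (c * (β - α * m)))) ∧
    -- the expectations of `λ^+_t` and `λ^-_t`
    (∀ (a : Fin 2), ∀ t ∈ Set.Icc (0 : ℝ) T,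
      Integrable (intensity T (expBaseline μ₀ κ) (expExcitation α β) τ ε J a t) P ∧
      ∫ ω, intensity T (expBaseline μ₀ κ) (expExcitation α β) τ ε J a t ω ∂P =
        μ₀ * ((β + c) / (β - α * m + c) * Real.exp (κ * (t / T))
          - α * m / (β - α * m + c) * Real.exp (-(β - α * m) * t))) ∧
    -- the expected market activity increases exponentially at rate `κ / T`
    StrictMonoOn (fun t : ℝ => ∫ ω,
        (intensity T (expBaseline μ₀ κ) (expExcitation α β) τ ε J 0 t ω
          + intensity T (expBaseline μ₀ κ) (expExcitation α β) τ ε J 1 t ω) ∂P)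
      (Set.Icc (0 : ℝ) T) ∧
    (∀ t ∈ Set.Icc (0 : ℝ) T,
      2 * μ₀ * Real.exp (κ * (t / T)) ≤
        ∫ ω, (intensity T (expBaseline μ₀ κ) (expExcitation α β) τ ε J 0 t ω
          + intensity T (expBaseline μ₀ κ) (expExcitation α β) τ ε J 1 t ω) ∂P ∧
      ∫ ω, (intensity T (expBaseline μ₀ κ) (expExcitation α β) τ ε J 0 t ω
          + intensity T (expBaseline μ₀ κ) (expExcitation α β) τ ε J 1 t ω) ∂P ≤
        2 * μ₀ * ((β + c) / (β - α * m + c)) * Real.exp (κ * (t / T))) := by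
  have hTr : (0 : ℝ) < T := by exact_mod_cast hT
  have hc0 : 0 < κ / T := div_pos hκ hTr
  have hc1 : 0 < c := hc ▸ hc0
  have hJ : Integrable J₀ P := hJ₀.integrable one_le_two
  have hr : 0 < β - α * m := sub_pos.2 (hm.symm ▸ hstab)
  have hm0 : 0 ≤ m := hm ▸ hN.integral_mark_nonneg
  have hκt : ∀ t : ℝ, κ * (t / T) = c * t := fun t => by rw [hc]; ring
  have hf : ∀ (a : Fin 2), ∀ t ∈ Set.Icc (0 : ℝ) T,
      Integrable (jumpSum τ ε J a t) P ∧
      ∫ ω, jumpSum τ ε J a t ω ∂P =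
        μ₀ * m * ((β + c) / (c * (β - α * m + c)) * Real.exp (κ * (t / T))
          + α * m / ((β - α * m) * (β - α * m + c)) * Real.exp (-(β - α * m) * t)
          - β / (c * (β - α * m))) := by
    intro a t ht
    lift t to ℝ≥0 using ht.1
    have htT : t ≤ T := by exact_mod_cast ht.2
    refine ⟨hN.integrable_jumpSum hJ hμ₀ hc0 hα hβ hstab a htT, ?_⟩
    rw [(hN.integral_discountedSum_and_jumpSum hJ hμ₀ hc0 hα hβ hstab a htT hm hc).2, hκt]
    generalize Real.exp (-(β - α * m) * t) = y, Real.exp (c * t) = x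
    generalize hR : β - α * m = r at hr ⊢
    obtain rfl : β = r + α * m := by linarith
    have hrc : r + c ≠ 0 := by positivity
    field_simp
    ring
  have hl : ∀ (a : Fin 2), ∀ t ∈ Set.Icc (0 : ℝ) T,
      Integrable (intensity T (expBaseline μ₀ κ) (expExcitation α β) τ ε J a t) P ∧
      ∫ ω, intensity T (expBaseline μ₀ κ) (expExcitation α β) τ ε J a t ω ∂P =
        μ₀ * ((β + c) / (β - α * m + c) * Real.exp (κ * (t / T))
          - α * m / (β - α * m + c) * Real.exp (-(β - α * m) * t)) := by
    intro a t ht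
    lift t to ℝ≥0 using ht.1
    have htT : t ≤ T := by exact_mod_cast ht.2
    have hg := (hN.integrable_discountedSum hJ hμ₀ hc0 hα hβ hstab (a + 1) htT).const_mul α
    have heq : intensity T (expBaseline μ₀ κ) (expExcitation α β) τ ε J a t = fun ω =>
        μ₀ * Real.exp (κ / T * t) + α * discountedSum β τ ε J (a + 1) t ω :=
      funext fun ω => intensity_eq T μ₀ κ α β a t ω
    rw [heq]
    refine ⟨(integrable_const _).add hg, ?_⟩
    rw [integral_add (integrable_const _) hg, integral_const_mul α,
      (hN.integral_discountedSum_and_jumpSum hJ hμ₀ hc0 hα hβ hstab (a + 1) htT hm hc).1, hκt, ← hc]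
    simp only [integral_const, probReal_univ, one_smul]
    generalize Real.exp (-(β - α * m) * t) = y, Real.exp (c * t) = x
    generalize hR : β - α * m = r at hr ⊢
    obtain rfl : β = r + α * m := by linarith
    have hrc : r + c ≠ 0 := by positivity
    field_simp
    ring
  have hA : ∀ t ∈ Set.Icc (0 : ℝ) T, ∫ ω,
      (intensity T (expBaseline μ₀ κ) (expExcitation α β) τ ε J 0 t ω
        + intensity T (expBaseline μ₀ κ) (expExcitation α β) τ ε J 1 t ω) ∂P =
      2 * μ₀ * ((β + c) / (β - α * m + c) * Real.exp (κ * (t / T))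
          - α * m / (β - α * m + c) * Real.exp (-(β - α * m) * t)) := by
    intro t ht
    rw [integral_add (hl 0 t ht).1 (hl 1 t ht).1, (hl 0 t ht).2, (hl 1 t ht).2]
    ring
  have hB0 : 0 ≤ α * m / (β - α * m + c) := by positivity
  refine ⟨hf, hl, ?_, ?_⟩
  · intro s hs t ht hst
    simp only
    rw [hA s hs, hA t ht, hκt, hκt]
    -- The growing exponential gives strictness; the decaying one enters with a coefficient of the
    -- right sign.
    have h1 : Real.exp (c * s) < Real.exp (c * t) := Real.exp_lt_exp.2 (by nlinarith)
    have h2 : Real.exp (-(β - α * m) * t) ≤ Real.exp (-(β - α * m) * s) :=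
      Real.exp_le_exp.2 (by nlinarith)
    have hA0 : 0 < (β + c) / (β - α * m + c) := by positivity
    have h3 := mul_lt_mul_of_pos_left h1 hA0
    have h4 := mul_le_mul_of_nonneg_left h2 hB0
    exact mul_lt_mul_of_pos_left (by linarith) (by positivity)
  · intro t ht
    rw [hA t ht, hκt]
    have h1 : Real.exp (-(β - α * m) * t) ≤ Real.exp (c * t) :=
      Real.exp_le_exp.2 (by nlinarith [ht.1])
    have h2 := mul_le_mul_of_nonneg_left h1 hB0
    -- Writing the leading coefficient as 1 + B, the activity is 2μ₀(e^{ct} + B(e^{ct} -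
    -- e^{-(β-αm)t})) with B ≥ 0, whence the lower bound. Dropping the decaying term gives the upper
    -- one.
    have h3 : (β + c) / (β - α * m + c) = 1 + α * m / (β - α * m + c) := by
      field_simp
      ring
    refine ⟨mul_le_mul_of_nonneg_left ?_ (by positivity), ?_⟩
    · rw [h3]
      linarith
    · rw [mul_assoc (2 * μ₀)]
      refine mul_le_mul_of_nonneg_left ?_ (by positivity)
      have := mul_nonneg hB0 (Real.exp_pos (-(β - α * m) * t)).le
      linarith
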